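/- Write $[n]=\{1,\dots,n\}$. A cost function on $[n]$ assigns a real number $c(x,Y)\ge 0$ to every $Y\subseteq[n]$ and $x\in Y$. For a probability distribution $\mathcal D$ on a finite set, $H(\mathcal D)=\sum_S \Pr_{\mathcal D}[S]\ln\frac{1}{\Pr_{\mathcal D}[S]}$ denotes its entropy (terms with $\Pr_{\mathcal D}[S]=0$ count as $0$). Theorem. For every $\delta>0$ there is a constant $C>0$, depending only on $\delta$, such that the following holds. Let $n,k\ge 0$ be integers with $\min(k,n-k)\ge \delta n$, let $\mathcal D$ be a probability distribution on the $k$-element subsets of $[n]$, and let $\alpha\ge 1$. Assume that for every cost function $c$ on $[n]$ satisfying $$\frac{1}{k+1}\sum_{s\in S'}c(s,S')\le 1\qquad\text{for every } S'\subseteq[n]\text{ with }|S'|=k+1,$$ one has $$\mathbb E\big[c(s,S\cup\{s\})\big]\le\alpha ,$$ where $S$ is drawn from $\mathcal D$ and then $s$ is drawn uniformly from $[n]\setminus S$. Then $$\alpha\ge C\,n\qquad\text{or}\qquad H(\mathcal D)\ge C\,\frac{n}{\alpha}\,\ln(1+\alpha).$$ -/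

import Mathlib

open scoped BigOperators

/-- The `k`-element subsets of `[n]`, with `[n]` modelled by `Fin n`. -/
abbrev KSubset (n k : ℕ) : Type := {S : Finset (Fin n) // S.card = k}

/-- The Shannon entropy (in nats) of a distribution on the `k`-subsets of `[n]`: the expectation of
the self information `-log (D S)`. A point of probability `0` contributes `0`. -/
noncomputable def entropy {n k : ℕ} (D : PMF (KSubset n k)) : ℝ :=
  ∑ S : KSubset n k, (D S).toReal * (-Real.log (D S).toReal)

/-- A cost function on `[n]` gives a nonnegative cost `c x Y` to every `Y ⊆ [n]` and `x ∈ Y`;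
the values `c x Y` with `x ∉ Y` carry no meaning and are never used. -/
def IsCostFunction {n : ℕ} (c : Fin n → Finset (Fin n) → ℝ) : Prop :=
  ∀ Y : Finset (Fin n), ∀ x ∈ Y, 0 ≤ c x Y

/-- The expected cost `c(s, S ∪ {s})` of adding `s` to `S`, where `S` is drawn from `D` and then
`s` is uniformly distributed in `[n] \ S`. -/
noncomputable def expectedInsertCost {n k : ℕ} (D : PMF (KSubset n k))
    (c : Fin n → Finset (Fin n) → ℝ) : ℝ :=
  ∑ S : KSubset n k, (D S).toReal * 𝔼 s ∈ (S.1)ᶜ, c s (insert s S.1)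

/-- For every cost function whose average over every set of size `k + 1` is at most `1`, the
expected cost of adding a uniformly random outside element to `S ∼ D` is at most `α`. -/
def SingleBatchEfficient {n k : ℕ} (D : PMF (KSubset n k)) (α : ℝ) : Prop :=
  ∀ c : Fin n → Finset (Fin n) → ℝ, IsCostFunction c →
    (∀ Y : Finset (Fin n), Y.card = k + 1 → 𝔼 s ∈ Y, c s Y ≤ 1) →
    expectedInsertCost D c ≤ α

/-! For each `(k+1)`-set `Y`, charge only the insertion that completes a heaviest `k`-subset of `Y`.
Batch efficiency then bounds the sum over `Y` of the maximal mass of a `k`-subset of `Y`. Decompose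
`D` into superlevel layers `F` with weights `μ F`; this sum becomes `∑ μ F * |∂⁺ F|`, while `∑ μ F *
|F| = 1` (`exists_layers_of_singleBatchEfficient`). By Markov, at least half of the mass sits on
layers with `|∂⁺ F|` at most about `2α(n-k)/k` times `|F|`. Kruskal-Katona makes such layers
exponentially large (`choose_le_card_of_upShadow`), and concavity of entropy carries their log-sizes
over to `D` (`sum_mul_log_card_le`, `half_le_entropy`). -/

/-! ### Shadows and Kruskal-Katona -/

/-- Double counting of the incidences in a uniform set family. -/
lemma sum_card_memberSubfamily {α : Type*} [Fintype α] [DecidableEq α]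
    {𝒜 : Finset (Finset α)} {r : ℕ} (h𝒜 : ∀ S ∈ 𝒜, S.card = r) :
    ∑ a, (𝒜.memberSubfamily a).card = r * 𝒜.card := by
  have h (a : α) : (𝒜.memberSubfamily a).card = ∑ S ∈ 𝒜, if a ∈ S then 1 else 0 := by
    rw [Finset.memberSubfamily, Finset.card_image_of_injOn, Finset.card_filter]
    intro S hS T hT h
    simp only [Finset.coe_filter, Set.mem_ofPred_eq] at hS hT
    exact Finset.erase_injOn' a hS.2 hT.2 h
  simp_rw [h]
  rw [Finset.sum_comm, Finset.sum_congr rfl (g := fun _ => r), Finset.sum_const, smul_eq_mul,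
    mul_comm]
  intro S hS
  simp [h𝒜 S hS]

/-- A clique-counting form of the Lovász version of the Kruskal-Katona theorem. -/
theorem card_mul_le_of_card_lt_choose {α : Type*} [Fintype α] [DecidableEq α] (m : ℕ) :
    ∀ (r : ℕ) (𝒜 𝒢 : Finset (Finset α)), (∀ S ∈ 𝒜, S.card = r + 1) →
      (∀ T ∈ 𝒢, T.card = r) → (∀ S ∈ 𝒜, ∀ a ∈ S, S.erase a ∈ 𝒢) →
      𝒢.card < (r + m).choose r → (r + 1) * 𝒜.card ≤ m * 𝒢.card := by
  intro r
  induction r with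
  | zero =>
    intro 𝒜 𝒢 h𝒜 _ hsh hlt
    have h𝒢 : 𝒢 = ∅ := by simpa using hlt
    have : 𝒜 = ∅ := by
      refine Finset.eq_empty_of_forall_notMem fun S hS => ?_
      obtain ⟨a, ha⟩ : S.Nonempty := Finset.card_pos.1 (by rw [h𝒜 S hS]; omega)
      simpa [h𝒢] using hsh S hS a ha
    simp [this]
  | succ r ih =>
    intro 𝒜 𝒢 h𝒜 h𝒢 hsh hlt
    -- Local version in the link of `a`: a small link of `𝒢` is handled by induction; for a large
    -- one, the link of `𝒜` embeds into the members of `𝒢` avoiding `a`, which are few because `𝒢`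
    -- itself is small.
    have key (a : α) :
        (r + 1) * (𝒜.memberSubfamily a).card ≤ m * (𝒢.memberSubfamily a).card := by
      rcases lt_or_ge (𝒢.memberSubfamily a).card ((r + m).choose r) with hd | hd
      · refine ih _ _ ?_ ?_ ?_ hd
        · intro S hS
          rw [Finset.mem_memberSubfamily] at hS
          have := h𝒜 _ hS.1
          rw [Finset.card_insert_of_notMem hS.2] at this
          omega
        · intro S hS
          rw [Finset.mem_memberSubfamily] at hS
          have := h𝒢 _ hS.1
          rw [Finset.card_insert_of_notMem hS.2] at this
          omega
        · intro S hS b hb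
          rw [Finset.mem_memberSubfamily] at hS ⊢
          have hne : a ≠ b := fun h => hS.2 (h ▸ hb)
          refine ⟨?_, fun h => hS.2 (Finset.mem_of_mem_erase h)⟩
          rw [← Finset.erase_insert_of_ne hne]
          exact hsh _ hS.1 b (Finset.mem_insert_of_mem hb)
      · have hsub : 𝒜.memberSubfamily a ⊆ 𝒢.nonMemberSubfamily a := by
          intro S hS
          rw [Finset.mem_memberSubfamily] at hS
          rw [Finset.mem_nonMemberSubfamily]
          refine ⟨?_, hS.2⟩
          simpa [Finset.erase_insert hS.2] using hsh _ hS.1 a (Finset.mem_insert_self _ _)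
        have h1 := Finset.card_le_card hsub
        have h2 := Finset.card_memberSubfamily_add_card_nonMemberSubfamily a 𝒢
        have h3 := Nat.add_one_mul_choose_eq (r + m) r
        have h4 : r + m + 1 = r + 1 + m := by omega
        rw [h4] at h3
        nlinarith
    have hsum := Finset.sum_le_sum fun a (_ : a ∈ Finset.univ) => key a
    rw [← Finset.mul_sum, ← Finset.mul_sum, sum_card_memberSubfamily h𝒜,
      sum_card_memberSubfamily h𝒢] at hsum
    refine Nat.le_of_mul_le_mul_left (c := r + 1) ?_ (Nat.succ_pos r)
    linarith

/-- A uniform family with small shadow is large. -/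
theorem choose_le_card_of_shadow {α : Type*} [Fintype α] [DecidableEq α] {r m : ℕ}
    {𝒜 𝒢 : Finset (Finset α)} (h𝒜 : ∀ S ∈ 𝒜, S.card = r + 1) (h𝒢 : ∀ T ∈ 𝒢, T.card = r)
    (hsh : ∀ S ∈ 𝒜, ∀ a ∈ S, S.erase a ∈ 𝒢) (hlt : m * 𝒢.card < (r + 1) * 𝒜.card) :
    (r + m).choose (r + 1) ≤ 𝒜.card := by
  have h1 : (r + m).choose r ≤ 𝒢.card := by
    by_contra! h
    exact absurd (card_mul_le_of_card_lt_choose m r 𝒜 𝒢 h𝒜 h𝒢 hsh h) (by omega)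
  have h2 := Nat.choose_succ_right_eq (r + m) r
  rw [Nat.add_sub_cancel_left] at h2
  refine Nat.le_of_mul_le_mul_left (c := r + 1) ?_ (Nat.succ_pos r)
  nlinarith

/-! ### Layer decomposition and entropy -/

/-- Every nonnegative function on a finite type is a nonnegative combination of indicators of its
superlevel sets, and its maximum over a nonempty set decomposes accordingly. -/
theorem exists_layer_decomposition {ι : Type*} [Fintype ι] [DecidableEq ι] (f : ι → ℝ)
    (hf : ∀ i, 0 ≤ f i) :
    ∃ μ : Finset ι → ℝ, (∀ F, 0 ≤ μ F) ∧ (∀ i, f i = ∑ F, if i ∈ F then μ F else 0) ∧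
      ∀ T : Finset ι, T.Nonempty →
        ∃ i ∈ T, ∑ F, (if (T ∩ F).Nonempty then μ F else 0) ≤ f i := by
  induction h : (Finset.univ.filter fun i => f i ≠ 0).card using Nat.strong_induction_on
    generalizing f with
  | _ N ih =>
  set P := Finset.univ.filter fun i => f i ≠ 0 with hP
  have memP (i : ι) : i ∈ P ↔ f i ≠ 0 := by simp [hP]
  rcases P.eq_empty_or_nonempty with he | hne
  · have h0 (i : ι) : f i = 0 := by
      by_contra hi
      simpa [he] using (memP i).2 hi
    refine ⟨fun _ => 0, fun _ => le_rfl, fun i => by simp [h0], ?_⟩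
    rintro T ⟨i, hi⟩
    exact ⟨i, hi, by simp [h0]⟩
  · obtain ⟨j, hj, hmin⟩ := Finset.exists_min_image P f hne
    -- Peel off the lowest level: subtracting the minimum of `f` on its support `P` shrinks the
    -- support.
    let g : ι → ℝ := fun i => if i ∈ P then f i - f j else 0
    have hg (i : ι) : 0 ≤ g i := by
      simp only [g]
      split_ifs with hi
      · linarith [hmin i hi]
      · exact le_rfl
    have hfg (i : ι) : f i = g i + if i ∈ P then f j else 0 := by
      simp only [g]
      split_ifs with hi
      · ring
      · simpa [memP] using hi
    have hlt : (Finset.univ.filter fun i => g i ≠ 0).card < N := by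
      rw [← h]
      refine Finset.card_lt_card ((Finset.ssubset_iff_of_subset ?_).2 ⟨j, hj, by simp [g]⟩)
      intro i hi
      by_contra hiP
      simp [g, hiP] at hi
    obtain ⟨μ, hμ, hdec, hmax⟩ := ih _ hlt g hg rfl
    have hsplit (p : Finset ι → Prop) [DecidablePred p] :
        ∑ F, (if p F then μ F + (if F = P then f j else 0) else 0)
          = (∑ F, if p F then μ F else 0) + if p P then f j else 0 := by
      have : ∀ F, (if p F then μ F + (if F = P then f j else 0) else 0)
          = (if p F then μ F else 0) + if F = P then (if p P then f j else 0) else 0 := by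
        intro F
        by_cases hF : F = P
        · subst hF; split_ifs <;> simp
        · simp [hF]
      simp_rw [this, Finset.sum_add_distrib]
      simp
    refine ⟨fun F => μ F + if F = P then f j else 0, fun F => ?_, fun i => ?_, fun T hT => ?_⟩
    · have := hμ F
      have := hf j
      dsimp only
      split_ifs <;> linarith
    · rw [hsplit fun F => i ∈ F, ← hdec]
      exact hfg i
    · rw [hsplit fun F => (T ∩ F).Nonempty]
      obtain ⟨i, hi, hle⟩ := hmax T hT
      by_cases hTP : (T ∩ P).Nonempty
      · rw [if_pos hTP]
        by_cases hiP : i ∈ P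
        · refine ⟨i, hi, ?_⟩
          rw [hfg i, if_pos hiP]
          linarith
        -- Here `g` vanishes at the maximizer `i`, so any point of `T ∩ P` serves instead.
        · obtain ⟨l, hl⟩ := hTP
          rw [Finset.mem_inter] at hl
          refine ⟨l, hl.1, ?_⟩
          rw [hfg l, if_pos hl.2]
          have h1 : g i = 0 := by simp [g, hiP]
          have := hg l
          linarith
      · rw [if_neg hTP]
        refine ⟨i, hi, ?_⟩
        have hiP : i ∉ P := fun hiP => hTP ⟨i, Finset.mem_inter.2 ⟨hi, hiP⟩⟩
        rw [hfg i, if_neg hiP]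
        linarith

/-- Concavity of entropy for a mixture of uniform distributions. -/
theorem sum_mul_log_card_le {ι : Type*} [Fintype ι] [DecidableEq ι] (f : ι → ℝ)
    (μ : Finset ι → ℝ) (hμ : ∀ F, 0 ≤ μ F) (hf : ∀ i, f i = ∑ F, if i ∈ F then μ F else 0)
    (hone : ∑ F, μ F * F.card = 1) :
    ∑ F, μ F * F.card * Real.log F.card ≤ ∑ i, Real.negMulLog (f i) := by
  let u : Finset ι → ι → ℝ := fun F i => if i ∈ F then (F.card : ℝ)⁻¹ else 0
  have hpos {F : Finset ι} {i : ι} (hi : i ∈ F) : (F.card : ℝ) ≠ 0 := by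
    exact_mod_cast Finset.card_ne_zero_of_mem hi
  -- Jensen at each point `i`, with weights `μ F * |F|` on the uniform densities `u F`.
  have hJ (i : ι) : ∑ F, μ F * F.card * Real.negMulLog (u F i) ≤ Real.negMulLog (f i) := by
    have h := Real.concaveOn_negMulLog.le_map_sum (t := Finset.univ)
      (w := fun F : Finset ι => μ F * F.card) (p := fun F => u F i)
      (fun F _ => mul_nonneg (hμ F) (Nat.cast_nonneg _)) hone
      (fun F _ => by simp only [u, Set.mem_Ici]; split_ifs <;> positivity)
    simp only [smul_eq_mul] at h
    have hfi : f i = ∑ F, μ F * F.card * u F i := by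
      rw [hf i]
      refine Finset.sum_congr rfl fun F _ => ?_
      simp only [u]
      split_ifs with hi
      · rw [mul_assoc, mul_inv_cancel₀ (hpos hi), mul_one]
      · simp
    rwa [hfi]
  refine le_trans (le_of_eq ?_) (Finset.sum_le_sum fun i _ => hJ i)
  rw [Finset.sum_comm]
  refine Finset.sum_congr rfl fun F _ => ?_
  rw [← Finset.mul_sum, mul_assoc, mul_assoc]
  congr 1
  have : ∑ i, Real.negMulLog (u F i) = F.card * ((F.card : ℝ)⁻¹ * Real.log F.card) := by
    have h1 (i : ι) : Real.negMulLog (u F i)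
        = if i ∈ F then (F.card : ℝ)⁻¹ * Real.log F.card else 0 := by
      simp only [u]
      split_ifs <;> simp [Real.negMulLog]
    simp [h1]
  rw [this]
  rcases eq_or_ne (F.card : ℝ) 0 with h0 | h0
  · simp [h0]
  · rw [mul_inv_cancel_left₀ h0]

/-! ### Upper shadows and numerical estimates -/

open scoped FinsetFamily in
/-- A family of `k`-subsets of `[n]` with small upper shadow is large. -/
theorem choose_le_card_of_upShadow {n k m : ℕ} (hk : k < n) {𝒜 : Finset (Finset (Fin n))}
    (h𝒜 : ∀ S ∈ 𝒜, S.card = k) (hlt : m * (∂⁺ 𝒜).card < (n - k) * 𝒜.card) :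
    (n - k - 1 + m).choose (n - k) ≤ 𝒜.card := by
  have hr : n - k - 1 + 1 = n - k := by omega
  have h1 : ∀ S ∈ 𝒜.compls, S.card = n - k - 1 + 1 := by
    intro S hS
    have h := h𝒜 _ (Finset.mem_compls.1 hS)
    have h' := Finset.card_add_card_compl S
    rw [Fintype.card_fin] at h'
    omega
  have h2 := choose_le_card_of_shadow (m := m) (𝒢 := ∂ 𝒜.compls) h1
    (fun T hT => by
      obtain ⟨S, hS, a, ha, rfl⟩ := Finset.mem_shadow_iff.1 hT
      rw [Finset.card_erase_of_mem ha, h1 S hS]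
      rfl)
    (fun S hS a ha => Finset.erase_mem_shadow hS ha)
  rw [hr, Finset.shadow_compls, Finset.card_compls, Finset.card_compls] at h2
  exact h2 hlt

/-- Compare `(a + p).choose p = ∏ i ∈ [1, p], (1 + a / i)` with a power. -/
theorem one_add_pow_le_choose {y : ℝ} (hy : 0 ≤ y) (a p : ℕ) (h : p * y ≤ a) :
    (1 + y) ^ p ≤ (a + p).choose p := by
  induction p with
  | zero => simp
  | succ p ih =>
    push_cast at h
    have h1 := ih (by nlinarith)
    have h2 : ((a + p + 1).choose (p + 1) : ℝ) * (p + 1) = (a + p + 1) * (a + p).choose p := by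
      exact_mod_cast (Nat.add_one_mul_choose_eq (a + p) p).symm
    have h3 : (p + 1) * (1 + y) ≤ (a + p + 1 : ℝ) := by linarith
    have hp : (0 : ℝ) < p + 1 := by positivity
    rw [← add_assoc]
    refine le_of_mul_le_mul_right ?_ hp
    rw [h2, pow_succ]
    calc (1 + y) ^ p * (1 + y) * (p + 1) = ((p + 1) * (1 + y)) * (1 + y) ^ p := by ring
      _ ≤ (a + p + 1) * (a + p).choose p := by gcongr

/-- Bernoulli's inequality for exponents in `[0, 1]`, after taking logarithms. -/
lemma mul_log_one_add_le {δ x : ℝ} (hδ : 0 ≤ δ) (hδ' : δ ≤ 1) (hx : 0 ≤ x) :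
    δ * Real.log (1 + x) ≤ Real.log (1 + δ * x) := by
  rw [← Real.log_rpow (by positivity)]
  exact Real.log_le_log (by positivity)
    (rpow_one_add_le_one_add_mul_self (by linarith) hδ hδ')

/-! ### Consequences of batch efficiency -/

/-- Testing the batch condition against the cost function that charges `k + 1` for a single
selected element of every `(k + 1)`-set. -/
theorem sum_selected_le {n k : ℕ} {D : PMF (KSubset n k)} {α : ℝ} (hk : k < n)
    (hD : SingleBatchEfficient D α) (sel : Finset (Fin n) → KSubset n k)
    (hsel : ∀ Y : Finset (Fin n), Y.card = k + 1 → (sel Y).1 ⊆ Y) :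
    (k + 1) * ∑ Y ∈ Finset.powersetCard (k + 1) Finset.univ, (D (sel Y)).toReal
      ≤ α * (n - k) := by
  let c : Fin n → Finset (Fin n) → ℝ := fun x Y => if Y.erase x = (sel Y).1 then k + 1 else 0
  have hc : IsCostFunction c := by
    intro Y x _
    simp only [c]
    split_ifs <;> positivity
  have hbound : ∀ Y : Finset (Fin n), Y.card = k + 1 → 𝔼 s ∈ Y, c s Y ≤ 1 := by
    intro Y hY
    rw [Finset.expect_eq_sum_div_card, hY]
    push_cast
    rw [div_le_one (by positivity)]
    simp only [c]
    rw [← Finset.sum_filter, Finset.sum_const, nsmul_eq_mul]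
    have : (Y.filter fun x => Y.erase x = (sel Y).1).card ≤ 1 := by
      rw [Finset.card_le_one]
      intro a ha b hb
      rw [Finset.mem_filter] at ha hb
      exact (Finset.erase_inj Y ha.1).1 (ha.2.trans hb.2.symm)
    have h' : ((Y.filter fun x => Y.erase x = (sel Y).1).card : ℝ) ≤ 1 := by exact_mod_cast this
    nlinarith [(Nat.cast_nonneg k : (0 : ℝ) ≤ k)]
  have hmain := hD c hc hbound
  have hnk : (0 : ℝ) < n - k := by
    have : (k : ℝ) < n := by exact_mod_cast hk
    linarith
  have hcard (S : KSubset n k) : ((S.1ᶜ).card : ℝ) = n - k := by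
    rw [Finset.card_compl, S.2, Fintype.card_fin, Nat.cast_sub hk.le]
  rw [expectedInsertCost] at hmain
  simp_rw [Finset.expect_eq_sum_div_card, hcard, ← mul_div_assoc] at hmain
  rw [← Finset.sum_div, div_le_iff₀ hnk] at hmain
  refine le_trans ?_ hmain
  have hmem (Y : Finset (Fin n)) (hY : Y.card = k + 1) :
      ∃ s ∉ (sel Y).1, insert s (sel Y).1 = Y := by
    have h1 : (Y \ (sel Y).1).card = 1 := by
      rw [Finset.card_sdiff_of_subset (hsel Y hY), hY, (sel Y).2]
      omega
    obtain ⟨s, hs⟩ := Finset.card_eq_one.1 h1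
    have h2 : s ∈ Y \ (sel Y).1 := by simp [hs]
    refine ⟨s, (Finset.mem_sdiff.1 h2).2, ?_⟩
    rw [Finset.insert_eq, ← hs, Finset.sdiff_union_of_subset (hsel Y hY)]
  have hne : Nonempty (Fin n) := ⟨⟨k, hk⟩⟩
  choose! t ht using hmem
  simp_rw [Finset.mul_sum]
  rw [Finset.sum_sigma']
  -- `Y` is recovered from its selected subset and the missing element, so the charged terms form a
  -- subsum of the expected cost.
  let φ : Finset (Fin n) → (_ : KSubset n k) × Fin n := fun Y => ⟨sel Y, t Y⟩
  let w : (_ : KSubset n k) × Fin n → ℝ := fun p => (D p.1).toReal * c p.2 (insert p.2 p.1.1)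
  have hφ : Set.InjOn φ (Finset.powersetCard (k + 1) (Finset.univ : Finset (Fin n))) := by
    intro Y hY Z hZ h
    rw [Finset.mem_coe, Finset.mem_powersetCard_univ] at hY hZ
    have h1 : sel Y = sel Z := congrArg (fun p => p.1) h
    have h2 : t Y = t Z := congrArg (fun p => p.2) h
    rw [← (ht Y hY).2, ← (ht Z hZ).2, h1, h2]
  have hw : ∀ Y ∈ Finset.powersetCard (k + 1) (Finset.univ : Finset (Fin n)),
      (k + 1) * (D (sel Y)).toReal = w (φ Y) := by
    intro Y hY
    rw [Finset.mem_powersetCard_univ] at hY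
    obtain ⟨h1, h2⟩ := ht Y hY
    have h3 : Y.erase (t Y) = (sel Y).1 := by
      have h4 := Finset.erase_insert h1
      rwa [h2] at h4
    simp only [w, φ, c, h2, h3, if_true]
    ring
  rw [Finset.sum_congr rfl hw, ← Finset.sum_image (f := w) hφ]
  refine Finset.sum_le_sum_of_subset_of_nonneg ?_ fun p _ _ => ?_
  · intro p hp
    obtain ⟨Y, hY, rfl⟩ := Finset.mem_image.1 hp
    rw [Finset.mem_powersetCard_univ] at hY
    simpa [φ] using (ht Y hY).1
  · exact mul_nonneg ENNReal.toReal_nonneg (hc _ _ (Finset.mem_insert_self _ _))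

/-- The members of a family of `k`-subsets, as plain sets. -/
def familySets {n k : ℕ} (F : Finset (KSubset n k)) : Finset (Finset (Fin n)) :=
  F.map (Function.Embedding.subtype _)

open scoped FinsetFamily in
/-- A batch efficient distribution is a mixture of uniform distributions on families whose upper
shadows are small on average. -/
theorem exists_layers_of_singleBatchEfficient {n k : ℕ} {D : PMF (KSubset n k)} {α : ℝ}
    (hk : k < n) (hD : SingleBatchEfficient D α) :
    ∃ μ : Finset (KSubset n k) → ℝ, (∀ F, 0 ≤ μ F) ∧
      (∀ S, (D S).toReal = ∑ F, if S ∈ F then μ F else 0) ∧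
      (k + 1) * ∑ F, μ F * (∂⁺ (familySets F)).card ≤ α * (n - k) := by
  obtain ⟨μ, hμ, hdec, hmax⟩ :=
    exists_layer_decomposition (fun S => (D S).toReal) fun _ => ENNReal.toReal_nonneg
  refine ⟨μ, hμ, hdec, ?_⟩
  have hsel : ∀ Y : Finset (Fin n), ∃ S : KSubset n k, Y.card = k + 1 → S.1 ⊆ Y ∧
      ∑ F, (if Y ∈ ∂⁺ (familySets F) then μ F else 0) ≤ (D S).toReal := by
    intro Y
    by_cases hY : Y.card = k + 1
    · obtain ⟨S, hSY, hS⟩ := Finset.exists_subset_card_eq (s := Y) (n := k) (by omega)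
      obtain ⟨i, hi, hle⟩ := hmax (Finset.univ.filter fun S => S.1 ⊆ Y) ⟨⟨S, hS⟩, by simpa⟩
      refine ⟨i, fun _ => ⟨(Finset.mem_filter.1 hi).2, le_trans ?_ hle⟩⟩
      refine Finset.sum_le_sum fun F _ => ?_
      by_cases hF : Y ∈ ∂⁺ (familySets F)
      · rw [if_pos hF, if_pos]
        obtain ⟨R, hR, hRY⟩ := Finset.exists_subset_of_mem_upShadow hF
        obtain ⟨R', hR', rfl⟩ := Finset.mem_map.1 hR
        exact ⟨R', Finset.mem_inter.2 ⟨Finset.mem_filter.2 ⟨Finset.mem_univ _, hRY⟩, hR'⟩⟩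
      · rw [if_neg hF]
        split_ifs
        exacts [hμ F, le_rfl]
    -- For other sizes of `Y` the selection is arbitrary.
    · obtain ⟨S, -, hS⟩ := Finset.exists_subset_card_eq (s := (Finset.univ : Finset (Fin n)))
        (n := k) (by simpa using hk.le)
      exact ⟨⟨S, hS⟩, fun h => absurd h hY⟩
  choose sel hsel using hsel
  refine le_trans ?_ (sum_selected_le hk hD sel fun Y hY => (hsel Y hY).1)
  refine mul_le_mul_of_nonneg_left ?_ (by positivity)
  refine le_trans (le_of_eq ?_) (Finset.sum_le_sum fun Y hY =>
    (hsel Y (Finset.mem_powersetCard_univ.1 hY)).2)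
  rw [Finset.sum_comm]
  refine Finset.sum_congr rfl fun F _ => ?_
  have hsub : ∂⁺ (familySets F) ⊆ Finset.powersetCard (k + 1) Finset.univ := by
    intro Y hY
    obtain ⟨R, hR, a, ha, rfl⟩ := Finset.mem_upShadow_iff.1 hY
    obtain ⟨R', hR', rfl⟩ := Finset.mem_map.1 hR
    rw [Finset.mem_powersetCard_univ, Finset.card_insert_of_notMem ha]
    exact congrArg (· + 1) R'.2
  rw [← Finset.sum_filter, Finset.filter_mem_eq_inter, Finset.inter_eq_right.2 hsub,
    Finset.sum_const, nsmul_eq_mul, mul_comm]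

/-! ### The entropy bound -/

open scoped FinsetFamily in
/-- The entropy bound for a mixture of uniform distributions, given a size bound for every family
whose upper shadow is at most `β` times as large as the family. -/
theorem half_le_entropy {n k : ℕ} {D : PMF (KSubset n k)} {β L : ℝ} (hβ : 0 < β) (hL : 0 ≤ L)
    (μ : Finset (KSubset n k) → ℝ) (hμ : ∀ F, 0 ≤ μ F)
    (hdec : ∀ S, (D S).toReal = ∑ F, if S ∈ F then μ F else 0)
    (hshadow : ∑ F, μ F * (∂⁺ (familySets F)).card ≤ β / 2)
    (hlarge : ∀ F : Finset (KSubset n k), F.Nonempty →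
      ((∂⁺ (familySets F)).card : ℝ) ≤ β * F.card → L ≤ Real.log F.card) :
    L / 2 ≤ entropy D := by
  have hone : ∑ F, μ F * F.card = 1 := by
    have h1 : ∑ S, (D S).toReal = 1 := by
      rw [← ENNReal.toReal_sum fun S _ => D.apply_ne_top S, ← tsum_fintype (L := .unconditional _),
        D.tsum_coe, ENNReal.toReal_one]
    simp_rw [hdec] at h1
    rw [Finset.sum_comm] at h1
    rw [← h1]
    refine Finset.sum_congr rfl fun F _ => ?_
    simp [mul_comm]
  have h := sum_mul_log_card_le (fun S => (D S).toReal) μ hμ hdec hone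
  have he : ∑ S, Real.negMulLog (D S).toReal = entropy D :=
    Finset.sum_congr rfl fun S _ => by rw [Real.negMulLog]; ring
  rw [← he]
  refine le_trans ?_ h
  -- Markov in linear form: the left side is nonpositive on layers with large shadow, and its total
  -- is at least `L - L / 2`.
  have hF : ∀ F, L * (μ F * F.card) - L / β * (μ F * (∂⁺ (familySets F)).card)
      ≤ μ F * F.card * Real.log F.card := by
    intro F
    rcases F.eq_empty_or_nonempty with rfl | hF
    · have : 0 ≤ L / β * (μ ∅ * (∂⁺ (familySets (∅ : Finset (KSubset n k)))).card) :=
        mul_nonneg (by positivity) (mul_nonneg (hμ _) (Nat.cast_nonneg _))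
      simpa using this
    · rcases le_total ((∂⁺ (familySets F)).card : ℝ) (β * F.card) with hs | hs
      · have h1 := mul_le_mul_of_nonneg_left (hlarge F hF hs)
          (mul_nonneg (hμ F) (Nat.cast_nonneg F.card))
        have : 0 ≤ L / β * (μ F * (∂⁺ (familySets F)).card) :=
          mul_nonneg (by positivity) (mul_nonneg (hμ _) (Nat.cast_nonneg _))
        linarith
      · have h1 : 0 ≤ μ F * F.card * Real.log F.card :=
          mul_nonneg (mul_nonneg (hμ F) (Nat.cast_nonneg _)) (Real.log_natCast_nonneg _)
        have h2 := mul_le_mul_of_nonneg_left hs (mul_nonneg (by positivity : 0 ≤ L / β) (hμ F))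
        have h3 : L / β * μ F * (β * F.card) = L * (μ F * F.card) := by field_simp
        linarith
  have hsum := Finset.sum_le_sum fun F (_ : F ∈ Finset.univ) => hF F
  rw [Finset.sum_sub_distrib, ← Finset.mul_sum, ← Finset.mul_sum, hone] at hsum
  have h4 := mul_le_mul_of_nonneg_left hshadow (by positivity : 0 ≤ L / β)
  have h5 : L / β * (β / 2) = L / 2 := by field_simp
  linarith

theorem mainTheorem3 (δ : ℝ) (hδ : 0 < δ) :
    ∃ C : ℝ, 0 < C ∧
      ∀ (n k : ℕ) (D : PMF (KSubset n k)) (α : ℝ), 1 ≤ α →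
        SingleBatchEfficient D α →
        δ * n ≤ min (k : ℝ) ((n : ℝ) - k) →
        C * n ≤ α ∨ C * (n / α * Real.log (1 + α)) ≤ entropy D := by
  -- One `δ` comes from `k ≥ δ n`, the other from `log (1 + δ α)`; `16` is `8` from rounding `p`
  -- times `2` from Markov.
  refine ⟨δ ^ 2 / 16, by positivity, fun n k D α hα hD hmin => ?_⟩
  rw [or_iff_not_imp_left, not_le]
  intro hlt
  obtain ⟨hδk, hδnk⟩ := le_min_iff.1 hmin
  have hα0 : 0 < α := by linarith
  have hn : (0 : ℝ) < n := by
    by_contra! h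
    nlinarith [sq_nonneg δ]
  have hδ1 : δ ≤ 1 := by
    by_contra! h
    nlinarith
  have hknR : (k : ℝ) < n := by nlinarith
  have hkn : k < n := by exact_mod_cast hknR
  have hk4 : 4 * α ≤ k := by nlinarith
  obtain ⟨μ, hμ, hdec, hsh⟩ := exists_layers_of_singleBatchEfficient hkn hD
  set p := ⌊(k : ℝ) / (4 * α)⌋₊ with hp
  have h4α : 0 < 4 * α := by positivity
  have hq1 : 1 ≤ (k : ℝ) / (4 * α) := by rwa [le_div_iff₀ h4α, one_mul]
  have hpq : (p : ℝ) * (4 * α) ≤ k := by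
    rw [← le_div_iff₀ h4α]
    exact Nat.floor_le (by positivity)
  have hqp : (k : ℝ) ≤ p * (8 * α) := by
    have h1 : (k : ℝ) / (4 * α) < p + 1 := Nat.lt_floor_add_one _
    have h2 : (1 : ℝ) ≤ p := by exact_mod_cast (Nat.one_le_floor_iff _).2 hq1
    rw [div_lt_iff₀ h4α] at h1
    nlinarith
  have hnk : (0 : ℝ) < n - k := by linarith
  have hlog : 0 ≤ Real.log (1 + α) := Real.log_nonneg (by linarith)
  have hlogle := mul_log_one_add_le hδ.le hδ1 hα0.le
  have hlog' : 0 ≤ Real.log (1 + δ * α) := (mul_nonneg hδ.le hlog).trans hlogle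
  have hk1 : (0 : ℝ) < k + 1 := by positivity
  have hmain := half_le_entropy (D := D) (β := 2 * α * (n - k) / (k + 1))
    (L := p * Real.log (1 + δ * α)) (by positivity) (by positivity) μ hμ hdec
    (by
      rw [div_div, le_div_iff₀ (by positivity)]
      linarith)
    (by
      intro F hF hFs
      have hsized : ∀ S ∈ familySets F, S.card = k := by
        intro S hS
        obtain ⟨R, -, rfl⟩ := Finset.mem_map.1 hS
        exact R.2
      have hcard : (familySets F).card = F.card := Finset.card_map _
      have hFpos : (0 : ℝ) < F.card := by exact_mod_cast hF.card_pos
      have hcond : (p + 1) * (Finset.upShadow (familySets F)).card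
          < (n - k) * (familySets F).card := by
        rw [hcard, ← Nat.cast_lt (α := ℝ)]
        push_cast [Nat.cast_sub hkn.le]
        -- Both `p * (2 * α)` and `2 * α` are at most `k / 2`, hence the `4 * α` in `p`.
        have h1 : (p + 1) * (2 * α) < (k : ℝ) + 1 := by linarith
        calc ((p : ℝ) + 1) * (Finset.upShadow (familySets F)).card
            ≤ (p + 1) * (2 * α * (n - k) / (k + 1) * F.card) := by gcongr
          _ = ((p + 1) * (2 * α)) * ((n - k) * F.card / (k + 1)) := by ring
          _ < (k + 1) * ((n - k) * F.card / (k + 1)) :=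
            mul_lt_mul_of_pos_right h1 (by positivity)
          _ = (n - k) * F.card := by field_simp
      have h2 := choose_le_card_of_upShadow hkn hsized hcond
      -- Taking `m = p + 1` absorbs the `-1` and leaves `(n - k + p).choose p`.
      have h3 : n - k - 1 + (p + 1) = n - k + p := by omega
      rw [hcard, h3, Nat.choose_symm_add] at h2
      have h4 := one_add_pow_le_choose (y := δ * α) (by positivity) (n - k) p (by
        rw [Nat.cast_sub hkn.le]
        nlinarith)
      rw [← Real.log_pow]
      exact Real.log_le_log (by positivity) (h4.trans (by exact_mod_cast h2)))
  refine le_trans ?_ hmain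
  have h5 : δ * n / α ≤ 8 * p := by
    rw [div_le_iff₀ hα0]
    linarith
  have h6 : δ * n / α * (δ * Real.log (1 + α)) ≤ 8 * p * Real.log (1 + δ * α) := by gcongr
  have h7 : δ ^ 2 / 16 * (n / α * Real.log (1 + α))
      = δ * n / α * (δ * Real.log (1 + α)) / 16 := by ring
  linarith
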